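/- **Models.** Memory is measured in words of $w(n)$ bits, where $n$ is the input size. *MPC.* There are $P(n)$ processors with $M(n)$ words of memory each; the input is given as the initial contents of these memories (taken from a set of admissible inputs). In each synchronous round every processor first performs an arbitrary local computation on its memory and on the messages received in the preceding round, and then sends a (possibly empty) sequence of words to each processor. On every admissible input, in every round, each processor sends at most $M(n)$ words and receives at most $M(n)$ words in total. *EMPC.* There are $p$ machines on a complete network with communication costs $C[a,b]\ge 0$, $C[a,a]=0$. Each machine has a main memory of $S$ words and an external memory. In each synchronous round a machine performs a finite sequence of steps, each determined by the machine, the round number and the contents of its main memory: an arbitrary computation inside the main memory, reading or writing one word of its external memory, reading one word of a message received in the preceding round, or sending one word to a machine. At the end of the round the sent words are delivered and stored in the external memory of the addressee. Every access to external memory costs $1$ and every word sent from $a$ to $b$ costs $C[a,b]$. The total external memory is the number of words of external memory of all machines together, including, for each machine, one buffer for the messages received in the preceding round and one for those arriving in the current round. *Simulation.* Processor $i\in\{0,\dots,P(n)-1\}$ is assigned to machine $i \bmod p$, and word $r\in\{0,\dots,M(n)-1\}$ of its memory is represented by word $\lfloor i/p\rfloor M(n)+r$ of the external memory of that machine. An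 EMPC algorithm simulates $T$ rounds of an MPC algorithm in $T$ rounds if, whenever it is started with an admissible input in the external memories so represented (other external cells arbitrary), with all main memories zero and with no pending messages, it performs $T$ rounds, and after $t$ rounds, for each $t\le T$, the external memories represent the contents of the processors' memories after $t$ rounds of the MPC algorithm. **Theorem.** Let $p\ge 1$ and $k\ge 0$ be constant integers. There is a constant $c$, depending only on $p$ and $k$, such that the following holds. Let $T,P,M,w:\mathbb N\to\mathbb N$ be such that the name of a processor fits into $k$ words, i.e. $P(n)\le 2^{k\,w(n)}$ for all $n$. Then for every $T(n)$-round MPC algorithm with $P(n)$ processors and $M(n)$ words of memory on each processor, and for all communication costs $C$, there is an EMPC algorithm for $p$ machines that, for every $n$, simulates the $T(n)$ rounds of the MPC algorithm in exactly $T(n)$ rounds, with at most $c\cdot M(n)$ words of main memory per machine (that is, $O(M(n))$) and at most $c\cdot M(n)\cdot P(n)$ words of total external memory (that is, $O(M(n)\cdot P(n))$). -/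

import Mathlib

open scoped NNReal

/-- A machine word of `w` bits. -/
abbrev Word (w : ℕ) : Type := BitVec w

/-- The contents of a memory of `s` words of `w` bits. -/
abbrev Memory (s w : ℕ) : Type := Fin s → Word w

/-! ### The MPC model -/

/-- An algorithm in the MPC model with `P` processors, each having `M` words of memory.
`inputs` is the set of admissible distributions of the input over the memories of the processors.
In round `t`, processor `i` applies `compute t i` to its memory and to the messages it received
(`inbox j` is the message from processor `j`); the result is its new memory and its outgoing
messages (one sequence of words for every addressee). Local computation is unrestricted. -/
structure MPCAlgorithm (P M w : ℕ) where
  inputs : Set (Fin P → Memory M w)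
  compute : ℕ → Fin P → Memory M w → (Fin P → List (Word w)) →
    Memory M w × (Fin P → List (Word w))

/-- The global state of an MPC computation between two rounds. -/
structure MPCConfig (P M w : ℕ) where
  mem : Fin P → Memory M w
  /-- `inbox i j` is the message from `j` waiting at `i`. -/
  inbox : Fin P → Fin P → List (Word w)

namespace MPCAlgorithm

variable {P M w : ℕ}

/-- The message from `i` to `j` that is sent in round `t` started in the state `c`. -/
def message (A : MPCAlgorithm P M w) (t : ℕ) (c : MPCConfig P M w) (i j : Fin P) :
    List (Word w) :=
  (A.compute t i (c.mem i) (c.inbox i)).2 j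

/-- The state of the computation on input `x` after `t` rounds. -/
def run (A : MPCAlgorithm P M w) (x : Fin P → Memory M w) : ℕ → MPCConfig P M w
  | 0 => ⟨x, fun _ _ => []⟩
  | t + 1 =>
    ⟨fun i => (A.compute t i ((A.run x t).mem i) ((A.run x t).inbox i)).1,
      fun j i => A.message t (A.run x t) i j⟩

/-- The communication constraint of the MPC model for a computation of `T` rounds: on admissible
inputs, in every round, every processor sends and receives messages of total length at most the
size `M` of its memory. -/
def RespectsMemory (A : MPCAlgorithm P M w) (T : ℕ) : Prop :=
  ∀ x ∈ A.inputs, ∀ t < T,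
    (∀ i, ∑ j, (A.message t (A.run x t) i j).length ≤ M) ∧
    (∀ j, ∑ i, (A.message t (A.run x t) i j).length ≤ M)

end MPCAlgorithm

/-! ### The EMPC model -/

/-- A complete network of `p` machines, weighted with the communication costs. -/
structure EMPCNetwork (p : ℕ) where
  commCost : Fin p → Fin p → ℝ≥0
  commCost_self : ∀ a, commCost a a = 0

/-- One step of the local computation of an EMPC machine with `S` words of main memory. Every
instruction tells the next contents of the main memory; whatever is read from or written to the
external memory, received or sent passes through the main memory one word at a time. -/
inductive EMPCInstr (p S w : ℕ) where
  /-- computation in the main memory -/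
  | internal (next : Memory S w)
  /-- read a word of the external memory -/
  | read (addr : ℕ) (next : Word w → Memory S w)
  /-- write a word to the external memory -/
  | write (addr : ℕ) (v : Word w) (next : Memory S w)
  /-- read the word at position `pos` of the message received from `src`, which is kept in external
  memory; the result is `none` beyond the end of the message -/
  | recv (src : Fin p) (pos : ℕ) (next : Option (Word w) → Memory S w)
  /-- send a word, appending it to the message to `dst` -/
  | send (dst : Fin p) (v : Word w) (next : Memory S w)
  /-- end the local computation of this round -/
  | halt (next : Memory S w)

/-- An algorithm for `p` machines in the EMPC model. Machine `a` has `mainSize` words of main memory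
and `extSize a + 2 * bufSize a` words of external memory: `extSize a` addressable words, and two
buffers, one with the messages received at the end of the preceding round, one for those that arrive
in the current round. In round `t`, machine `a` executes the instruction
`program t a m` whenever its main memory contains `m`. Computation within the main memory is
unrestricted. -/
structure EMPCAlgorithm (p w : ℕ) where
  mainSize : ℕ
  extSize : Fin p → ℕ
  bufSize : Fin p → ℕ
  program : ℕ → Fin p → Memory mainSize w → EMPCInstr p mainSize w

/-- The state of a machine during the local computation of a round. -/
structure EMPCState (p S w : ℕ) where
  main : Memory S w
  ext : ℕ → Word w
  /-- the words sent so far in this round, for every addressee -/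
  outbox : Fin p → List (Word w)
  /-- the total cost (communication and IO) incurred so far -/
  cost : ℝ≥0

/-- The global state of an EMPC computation between two rounds. -/
structure EMPCConfig (p S w : ℕ) where
  main : Fin p → Memory S w
  ext : Fin p → ℕ → Word w
  /-- `inbox a b` is the message from `b` waiting at `a`. -/
  inbox : Fin p → Fin p → List (Word w)
  cost : Fin p → ℝ≥0

/-- `EMPCLocalRun N a prog E inbox s s'`: the local computation of machine `a` with program `prog`
and received messages `inbox`, started in the state `s`, ends in the state `s'` after finitely many
steps, and accesses no address of the external memory outside the first `E`. An access to external
memory costs `1`, and sending a word to machine `b` costs `N.commCost a b`. -/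
inductive EMPCLocalRun {p S w : ℕ} (N : EMPCNetwork p) (a : Fin p)
    (prog : Memory S w → EMPCInstr p S w) (E : ℕ) (inbox : Fin p → List (Word w)) :
    EMPCState p S w → EMPCState p S w → Prop
  | internal (s s' : EMPCState p S w) (next : Memory S w)
      (hi : prog s.main = .internal next)
      (hr : EMPCLocalRun N a prog E inbox { s with main := next } s') :
      EMPCLocalRun N a prog E inbox s s'
  | read (s s' : EMPCState p S w) (addr : ℕ) (next : Word w → Memory S w)
      (hi : prog s.main = .read addr next) (ha : addr < E)
      (hr : EMPCLocalRun N a prog E inbox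
        { s with main := next (s.ext addr), cost := s.cost + 1 } s') :
      EMPCLocalRun N a prog E inbox s s'
  | write (s s' : EMPCState p S w) (addr : ℕ) (v : Word w) (next : Memory S w)
      (hi : prog s.main = .write addr v next) (ha : addr < E)
      (hr : EMPCLocalRun N a prog E inbox
        { s with main := next, ext := Function.update s.ext addr v, cost := s.cost + 1 } s') :
      EMPCLocalRun N a prog E inbox s s'
  | recv (s s' : EMPCState p S w) (src : Fin p) (pos : ℕ) (next : Option (Word w) → Memory S w)
      (hi : prog s.main = .recv src pos next)
      (hr : EMPCLocalRun N a prog E inbox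
        { s with main := next (inbox src)[pos]?, cost := s.cost + 1 } s') :
      EMPCLocalRun N a prog E inbox s s'
  | send (s s' : EMPCState p S w) (dst : Fin p) (v : Word w) (next : Memory S w)
      (hi : prog s.main = .send dst v next)
      (hr : EMPCLocalRun N a prog E inbox
        { s with
          main := next
          outbox := Function.update s.outbox dst (s.outbox dst ++ [v])
          cost := s.cost + N.commCost a dst } s') :
      EMPCLocalRun N a prog E inbox s s'
  | halt (s : EMPCState p S w) (next : Memory S w)
      (hi : prog s.main = .halt next) :
      EMPCLocalRun N a prog E inbox s { s with main := next }

namespace EMPCAlgorithm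

variable {p w : ℕ}

/-- The total external memory of all machines, in words. -/
def totalExternal (B : EMPCAlgorithm p w) : ℕ :=
  ∑ a, (B.extSize a + 2 * B.bufSize a)

/-- Round `t` leads from `c` to `c'`: every machine finishes its local computation, then the
messages are exchanged; they have to fit into the message buffers of the addressees. Storing an
arriving word in the external memory costs `1`. -/
def Round (B : EMPCAlgorithm p w) (N : EMPCNetwork p) (t : ℕ)
    (c c' : EMPCConfig p B.mainSize w) : Prop :=
  ∃ s : Fin p → EMPCState p B.mainSize w,
    (∀ a, EMPCLocalRun N a (B.program t a) (B.extSize a) (c.inbox a)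
      ⟨c.main a, c.ext a, fun _ => [], c.cost a⟩ (s a)) ∧
    (∀ a, ∑ b, ((s b).outbox a).length ≤ B.bufSize a) ∧
    c' = ⟨fun a => (s a).main, fun a => (s a).ext, fun a b => (s b).outbox a,
      fun a => (s a).cost + ((∑ b, ((s b).outbox a).length : ℕ) : ℝ≥0)⟩

/-- The processors are assigned to the machines cyclically, processor `i` to machine `i mod p`, and
the memories of the processors of a machine are stored there one after the other: word `r` of the
memory of processor `i` is at address `(i / p) * M + r` of the external memory. -/
def Stores {P M : ℕ} (ext : Fin p → ℕ → Word w) (mem : Fin P → Memory M w) : Prop :=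
  ∀ (i : Fin P) (a : Fin p), (i : ℕ) % p = a →
    ∀ r : Fin M, ext a ((i : ℕ) / p * M + r) = mem i r

/-- The algorithm `B`, run on the network `N`, simulates `T` rounds of the MPC algorithm `A` in `T`
rounds: if the external memories store an admissible input of `A` (what the other cells contain does
not matter), all bits of the main memories are `0` and no messages are waiting, then `B` performs
`T` rounds, and after `t` rounds, for every `t ≤ T`, the external memories store the contents that
the memories of the processors have after `t` rounds of `A`. -/
def Simulates {P M : ℕ} (B : EMPCAlgorithm p w) (N : EMPCNetwork p) (A : MPCAlgorithm P M w)
    (T : ℕ) : Prop :=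
  ∀ x ∈ A.inputs, ∀ ext : Fin p → ℕ → Word w, Stores ext x →
    ∃ c : ℕ → EMPCConfig p B.mainSize w,
      c 0 = ⟨fun _ _ => 0, ext, fun _ _ => [], fun _ => 0⟩ ∧
      (∀ t < T, B.Round N t (c t) (c (t + 1))) ∧
      ∀ t ≤ T, Stores (c t).ext (A.run x t).mem

end EMPCAlgorithm

/-! In each round a machine simulates its processors one after the other, using its main memory for
one processor at a time. It loads the processor's memory, reads all messages in its buffer and keeps
only the words addressed to this processor, sends the outgoing messages, and writes the new memory
over the old one. Reading the whole buffer again for every processor is wasteful, but the theorem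
bounds only rounds and space.

Since a machine receives words for many processors, every word travels in a packet of `2 * k + 1`
words: the names of addressee and sender, then the word itself. The fixed length makes packets
parsable without separators (`foldl_scan_wires`), and order is preserved, so the original messages
can be recovered (`foldl_scan_channel`, `messagesOf_receivedUpTo`). All processors together send at
most `M * P` words per round, hence buffers of `(2 * k + 1) * (M * P)` words suffice
(`sum_length_channel_le`).

For the main memory a counting argument is enough, because computation there is arbitrary. The
control state consists of a few counters, `M` words of processor memory, at most `M` received words
with their senders, and an incomplete packet. There are at most `2 ^ (w * c * M)` such states for a
constant `c` (`card_finiteState_le`), so they can be encoded injectively in `c * M` words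
(`Coding.nonempty`). `localRun` verifies one round of one machine, `simulator_round` the
preservation of the invariant `Represents`, and `simulator_simulates` iterates over the rounds. -/

namespace EMPCSimulation

/-! ### Packets -/

/-- The machine that simulates processor `i`. -/
def machine {P : ℕ} (p : ℕ) [NeZero p] (i : Fin P) : Fin p := Fin.ofNat p i

/-- A word of a message, together with the addressee and the sender of the message. -/
structure Packet (P w : ℕ) where
  dst : Fin P
  src : Fin P
  word : Word w

/-- Names of `k` words for the processors. -/
structure Naming (P k w : ℕ) where
  name : Fin P → List (Word w)
  decode : List (Word w) → Fin P
  length_name : ∀ i, (name i).length = k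
  decode_name : ∀ i, decode (name i) = i

theorem fintypeCard_word (w : ℕ) : Fintype.card (Word w) = 2 ^ w := by
  rw [Fintype.card_congr (BitVec.equivFin (m := w)).toEquiv, Fintype.card_fin]

/-- If the number of processors is at most `2 ^ (k * w)`, they can be named by `k` words. -/
theorem Naming.nonempty {P k w : ℕ} (hP : 0 < P) (hk : P ≤ 2 ^ (k * w)) :
    Nonempty (Naming P k w) := by
  have : Nonempty (Fin P) := ⟨⟨0, hP⟩⟩
  have hcard : Fintype.card (Fin P) ≤ Fintype.card (Fin k → Word w) := by
    rw [Fintype.card_fin, Fintype.card_fun, Fintype.card_fin, fintypeCard_word,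
      ← pow_mul, mul_comm w k]
    exact hk
  obtain ⟨f⟩ := Function.Embedding.nonempty_of_card_le hcard
  have hinj : Function.Injective fun i => List.ofFn (f i) :=
    fun i j h => f.injective (List.ofFn_injective h)
  exact ⟨⟨fun i => List.ofFn (f i), Function.invFun fun i => List.ofFn (f i), by simp,
    Function.leftInverse_invFun hinj⟩⟩

section Packets

variable {P k w p : ℕ} [NeZero p]

/-- The words sent for a packet. -/
def Naming.wire (ν : Naming P k w) (x : Packet P w) : List (Word w) :=
  ν.name x.dst ++ ν.name x.src ++ [x.word]

theorem Naming.length_wire (ν : Naming P k w) (x : Packet P w) :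
    (ν.wire x).length = 2 * k + 1 := by
  simp [Naming.wire, ν.length_name]; ring

theorem Naming.length_wires (ν : Naming P k w) (l : List (Packet P w)) :
    (l.flatMap ν.wire).length = (2 * k + 1) * l.length := by
  induction l with
  | nil => simp
  | cons x l ih => simp [ih, ν.length_wire]; ring

/-- The packets for the messages `m` of processor `j`. -/
def packets (m : Fin P → List (Word w)) (j : Fin P) : List (Packet P w) :=
  (List.finRange P).flatMap fun i => (m i).map fun v => ⟨i, j, v⟩

/-- The words sent for a list of packets, together with the machines that receive them. -/
def stream (p : ℕ) [NeZero p] (ν : Naming P k w) (l : List (Packet P w)) : List (Fin p × Word w) :=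
  l.flatMap fun x => (ν.wire x).map fun u => (machine p x.dst, u)

/-- The packets that machine `a` sends for its processors with numbers less than `n`, if the
message from `j` to `i` is `m i j`. -/
def outgoing (m : Fin P → Fin P → List (Word w)) (a : Fin p) (n : ℕ) : List (Packet P w) :=
  ((List.finRange P).take n).flatMap fun j =>
    if machine p j = a then packets (fun i => m i j) j else []

/-- The words that machine `a` sends to machine `b` for its processors with numbers less
than `n`. -/
def channel (ν : Naming P k w) (m : Fin P → Fin P → List (Word w)) (a : Fin p) (n : ℕ)
    (b : Fin p) : List (Word w) :=
  ((outgoing m a n).filter fun x => machine p x.dst = b).flatMap ν.wire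

/-- Appends the words of `l` to the messages to the respective addressees. -/
def deliver (out : Fin p → List (Word w)) (l : List (Fin p × Word w)) (b : Fin p) :
    List (Word w) :=
  out b ++ (l.filter fun x => x.1 = b).map Prod.snd

-- The right-hand side is the effect of one `send` instruction on the outbox.
omit [NeZero p] in
theorem deliver_append_singleton (out : Fin p → List (Word w)) (l : List (Fin p × Word w))
    (x : Fin p × Word w) :
    deliver out (l ++ [x]) =
      Function.update (deliver out l) x.1 (deliver out l x.1 ++ [x.2]) := by
  funext b
  by_cases h : b = x.1
  · subst h
    simp [deliver]
  · simp [deliver, Function.update_of_ne h, Ne.symm h]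

/-- All words of a packet go to the same machine, so selecting by machine never splits a packet. -/
theorem filter_stream (ν : Naming P k w) (l : List (Packet P w)) (b : Fin p) :
    ((stream p ν l).filter fun x => x.1 = b).map Prod.snd =
      (l.filter fun x => machine p x.dst = b).flatMap ν.wire := by
  induction l with
  | nil => simp [stream]
  | cons x l ih =>
    have hx : stream p ν (x :: l) =
      (ν.wire x).map (fun u => (machine p x.dst, u)) ++ stream p ν l := by simp [stream]
    rw [hx, List.filter_append, List.map_append, ih]
    by_cases h : machine p x.dst = b
    · simp [h, List.filter_map, Function.comp_def]
    · simp [h, List.filter_map, Function.comp_def]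

theorem length_stream (ν : Naming P k w) (l : List (Packet P w)) :
    (stream p ν l).length = (2 * k + 1) * l.length := by
  induction l with
  | nil => simp [stream]
  | cons x l ih =>
    have hx : stream p ν (x :: l) =
      (ν.wire x).map (fun u => (machine p x.dst, u)) ++ stream p ν l := by simp [stream]
    simp [hx, ih, ν.length_wire]; ring

theorem length_packets (m : Fin P → List (Word w)) (j : Fin P) :
    (packets m j).length = ∑ i, (m i).length := by
  simp [packets, List.length_flatMap, Fin.sum_univ_def]

theorem outgoing_zero (m : Fin P → Fin P → List (Word w)) (a : Fin p) : outgoing m a 0 = [] := by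
  simp [outgoing]

theorem outgoing_succ (m : Fin P → Fin P → List (Word w)) (a : Fin p) (j : Fin P) :
    outgoing m a (j + 1) =
      outgoing m a j ++ if machine p j = a then packets (fun i => m i j) j else [] := by
  have h := List.take_append_getElem (l := List.finRange P) (i := j) (by simp)
  rw [outgoing, ← h, List.flatMap_append, outgoing]
  simp

theorem channel_zero (ν : Naming P k w) (m : Fin P → Fin P → List (Word w)) (a : Fin p) :
    channel ν m a 0 = fun _ => [] := by
  funext b
  simp [channel, outgoing_zero]

theorem channel_succ_of_ne (ν : Naming P k w) (m : Fin P → Fin P → List (Word w)) {a : Fin p}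
    {j : Fin P} (h : machine p j ≠ a) : channel ν m a (j + 1) = channel ν m a j := by
  funext b
  simp [channel, outgoing_succ, h]

theorem channel_succ (ν : Naming P k w) (m : Fin P → Fin P → List (Word w)) {a : Fin p}
    {j : Fin P} (h : machine p j = a) :
    channel ν m a (j + 1) =
      deliver (channel ν m a j) (stream p ν (packets (fun i => m i j) j)) := by
  funext b
  rw [deliver, filter_stream]
  simp [channel, outgoing_succ, h]

theorem outgoing_all (m : Fin P → Fin P → List (Word w)) (a : Fin p) :
    outgoing m a P = (List.finRange P).flatMap fun j =>
      if machine p j = a then packets (fun i => m i j) j else [] := by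
  rw [outgoing, List.take_of_length_le (by simp)]

/-- Gives the invariant on the inboxes before the first round, when no messages are pending. -/
theorem channel_nil (ν : Naming P k w) (a b : Fin p) :
    channel ν (fun _ _ : Fin P => []) a P b = [] := by
  have : ∀ j : Fin P, packets (fun _ => ([] : List (Word w))) j = [] := by simp [packets]
  simp [channel, outgoing_all, this]

/-- The messages that arrive at a machine fit into its buffer. -/
theorem sum_length_channel_le (ν : Naming P k w) (m : Fin P → Fin P → List (Word w)) {M : ℕ}
    (hm : ∀ j, ∑ i, (m i j).length ≤ M) (b : Fin p) :
    ∑ a, (channel ν m a P b).length ≤ (2 * k + 1) * (M * P) := by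
  have h1 : ∀ a : Fin p, (channel ν m a P b).length ≤
      (2 * k + 1) * ∑ j : Fin P, if machine p j = a then M else 0 := by
    intro a
    rw [channel, ν.length_wires]
    refine Nat.mul_le_mul_left _ ((List.length_filter_le _ _).trans ?_)
    rw [outgoing_all, List.length_flatMap, ← Fin.sum_univ_def]
    refine Finset.sum_le_sum fun j _ => ?_
    split_ifs
    · rw [length_packets fun i => m i j]; exact hm j
    · simp
  refine (Finset.sum_le_sum fun a _ => h1 a).trans ?_
  rw [← Finset.mul_sum, Finset.sum_comm]
  simp [mul_comm]

/-! ### Parsing the incoming words -/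

/-- Appends a word to the buffer `s.2`. If this completes a packet, the packet is removed from the
buffer, and if it is addressed to `i`, then sender and content are appended to `s.1`. -/
def scan (ν : Naming P k w) (i : Fin P) (s : List (Fin P × Word w) × List (Word w)) (v : Word w) :
    List (Fin P × Word w) × List (Word w) :=
  if s.2.length = 2 * k then
    (if ν.decode (s.2.take k) = i then s.1 ++ [(ν.decode (s.2.drop k), v)] else s.1, [])
  else (s.1, s.2 ++ [v])

/-- Sender and content of the packets addressed to `i`. -/
def received (i : Fin P) (l : List (Packet P w)) : List (Fin P × Word w) :=
  (l.filter fun x => x.dst = i).map fun x => (x.src, x.word)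

theorem foldl_scan_short (ν : Naming P k w) (i : Fin P) (acc : List (Fin P × Word w))
    (l buf : List (Word w)) (h : buf.length + l.length ≤ 2 * k) :
    l.foldl (scan ν i) (acc, buf) = (acc, buf ++ l) := by
  induction l generalizing buf with
  | nil => simp
  | cons v l ih =>
    simp only [List.length_cons] at h
    have hv : scan ν i (acc, buf) v = (acc, buf ++ [v]) := by
      rw [scan, if_neg]; dsimp only; omega
    rw [List.foldl_cons, hv, ih _ (by simp; omega)]
    simp

/-- The first `2 * k` words only fill the buffer; the last word completes the packet and empties the
buffer again, so the next packet is parsed from the same situation. -/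
theorem foldl_scan_wire (ν : Naming P k w) (i : Fin P) (acc : List (Fin P × Word w))
    (x : Packet P w) :
    (ν.wire x).foldl (scan ν i) (acc, []) = (acc ++ received i [x], []) := by
  rw [Naming.wire, List.foldl_append, foldl_scan_short ν i acc (ν.name x.dst ++ ν.name x.src) []]
  · have h1 := ν.length_name x.dst
    have h2 := ν.length_name x.src
    have h3 : (ν.name x.dst ++ ν.name x.src).length = 2 * k := by rw [List.length_append, h1, h2, two_mul]
    rw [List.foldl_cons, List.foldl_nil, List.nil_append, scan, if_pos h3, List.take_left' h1,
      List.drop_left' h1, ν.decode_name, ν.decode_name]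
    by_cases h : x.dst = i <;> simp [received, h]
  · simp [ν.length_name]; omega

theorem foldl_scan_wires (ν : Naming P k w) (i : Fin P) (acc : List (Fin P × Word w))
    (l : List (Packet P w)) :
    (l.flatMap ν.wire).foldl (scan ν i) (acc, []) = (acc ++ received i l, []) := by
  induction l generalizing acc with
  | nil => simp [received]
  | cons x l ih =>
    rw [List.flatMap_cons, List.foldl_append, foldl_scan_wire, ih, List.append_assoc]
    congr 2
    simp [received, List.filter_cons]
    split_ifs <;> simp

theorem length_scan_buf_le (ν : Naming P k w) (i : Fin P)
    (s : List (Fin P × Word w) × List (Word w)) (v : Word w) (h : s.2.length ≤ 2 * k) :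
    (scan ν i s v).2.length ≤ 2 * k := by
  unfold scan
  split_ifs
  · simp
  · simp
  · rw [List.length_append, List.length_singleton]
    omega

/-- Scanning never discards an accepted word. Hence a bound on the final list also bounds every
intermediate one, which has to fit into main memory. -/
theorem length_le_length_foldl_scan (ν : Naming P k w) (i : Fin P) (l : List (Word w))
    (s : List (Fin P × Word w) × List (Word w)) :
    s.1.length ≤ (l.foldl (scan ν i) s).1.length := by
  induction l generalizing s with
  | nil => simp
  | cons v l ih =>
    refine le_trans ?_ (ih _)
    unfold scan
    split_ifs <;> simp

/-- What processor `i` receives from the processors on machine `b`. -/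
def receivedFrom (m : Fin P → Fin P → List (Word w)) (i : Fin P) (b : Fin p) :
    List (Fin P × Word w) :=
  (List.finRange P).flatMap fun j => if machine p j = b then (m i j).map fun v => (j, v) else []

theorem flatMap_ite_eq {α β : Type*} [DecidableEq α] {l : List α} (hl : l.Nodup) {a : α}
    (ha : a ∈ l) (L : List β) : (l.flatMap fun x => if x = a then L else []) = L := by
  induction l with
  | nil => simp at ha
  | cons x l ih =>
    rw [List.nodup_cons] at hl
    by_cases h : x = a
    · subst h
      have : (l.flatMap fun y => if y = x then L else []) = [] := by
        rw [List.flatMap_eq_nil_iff]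
        intro y hy
        rw [if_neg]
        rintro rfl
        exact hl.1 hy
      simp [this]
    · have ha' : a ∈ l := by simpa [Ne.symm h] using ha
      simp [h, ih hl.2 ha']

theorem received_packets (m : Fin P → List (Word w)) (i j : Fin P) :
    received i (packets m j) = (m i).map fun v => (j, v) := by
  rw [received, packets, List.filter_flatMap, List.map_flatMap]
  rw [← flatMap_ite_eq (List.nodup_finRange P) (List.mem_finRange i) ((m i).map fun v => (j, v))]
  congr 1
  funext x
  by_cases h : x = i
  · simp [h, List.filter_map, Function.comp_def]
  · simp [h, List.filter_map, Function.comp_def]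

/-- Packets for `i` all go to the machine of `i`, so restricting to the words sent to that machine
loses none of them, and the scan drops those for its other processors. -/
theorem foldl_scan_channel (ν : Naming P k w) (m : Fin P → Fin P → List (Word w)) (i : Fin P)
    (b : Fin p) (acc : List (Fin P × Word w)) :
    (channel ν m b P (machine p i)).foldl (scan ν i) (acc, []) =
      (acc ++ receivedFrom m i b, []) := by
  rw [channel, foldl_scan_wires]
  have h1 : received i ((outgoing m b P).filter fun x => machine p x.dst = machine p i) =
      received i (outgoing m b P) := by
    rw [received, List.filter_filter, received]
    congr 2
    funext x
    by_cases h : x.dst = i <;> simp [h]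
  rw [h1, outgoing_all, received, List.filter_flatMap, List.map_flatMap, receivedFrom]
  congr 3
  funext j
  split_ifs
  · exact received_packets (fun i => m i j) i j
  · simp

/-- The messages contained in the list `acc` of senders and words. -/
def messagesOf (acc : List (Fin P × Word w)) (j : Fin P) : List (Word w) :=
  (acc.filter fun x => x.1 = j).map Prod.snd

/-- All that is received from the first `n` machines. -/
def receivedUpTo (p : ℕ) [NeZero p] (m : Fin P → Fin P → List (Word w)) (i : Fin P) (n : ℕ) :
    List (Fin P × Word w) :=
  ((List.finRange p).take n).flatMap fun b => receivedFrom m i b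

theorem receivedUpTo_succ (m : Fin P → Fin P → List (Word w)) (i : Fin P) (b : Fin p) :
    receivedUpTo p m i (b + 1) = receivedUpTo p m i b ++ receivedFrom m i b := by
  have h := List.take_append_getElem (l := List.finRange p) (i := b) (by simp)
  rw [receivedUpTo, ← h, List.flatMap_append, receivedUpTo]
  simp

theorem length_receivedUpTo_le (m : Fin P → Fin P → List (Word w)) (i : Fin P) (n : ℕ) :
    (receivedUpTo p m i n).length ≤ ∑ j, (m i j).length := by
  have h1 : (receivedUpTo p m i n).length ≤
      ((List.finRange p).flatMap fun b => receivedFrom m i b).length := by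
    conv_rhs => rw [← List.take_append_drop n (List.finRange p), List.flatMap_append]
    rw [List.length_append, receivedUpTo]
    exact Nat.le_add_right _ _
  refine h1.trans (le_of_eq ?_)
  simp only [receivedFrom, List.length_flatMap, ← Fin.sum_univ_def]
  rw [Finset.sum_comm]
  refine Finset.sum_congr rfl fun j _ => ?_
  simp [apply_ite List.length]

/-- The words from `j` all come from the single machine of `j` and stay in order; interleaving with
other senders is undone by filtering on the sender. -/
theorem messagesOf_receivedUpTo (m : Fin P → Fin P → List (Word w)) (i : Fin P) :
    messagesOf (receivedUpTo p m i p) = m i := by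
  funext j
  rw [messagesOf, receivedUpTo, List.take_of_length_le (by simp), List.filter_flatMap,
    List.map_flatMap,
    ← flatMap_ite_eq (List.nodup_finRange p) (List.mem_finRange (machine p j)) (m i j)]
  congr 1
  funext b
  rw [receivedFrom, List.filter_flatMap, List.map_flatMap,
    ← flatMap_ite_eq (List.nodup_finRange P) (List.mem_finRange j)
      (if b = machine p j then m i j else [])]
  congr 1
  funext j'
  by_cases h : j' = j
  · subst h
    by_cases hb : machine p j' = b
    · simp [hb, List.filter_map, Function.comp_def]
    · simp [hb, Ne.symm hb]
  · by_cases hb : machine p j' = b <;> simp [h, hb, List.filter_map, Function.comp_def]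

end Packets

/-! ### The contents of the main memory -/

/-- What a simulating machine keeps in its main memory. The phases of the simulation of processor
`proc` are: loading its memory (`0`), scanning the messages from machine `b` (`b + 3`),
sending (`1`) and storing the new memory (`2`). -/
structure State (P M w : ℕ) where
  phase : ℕ
  proc : ℕ
  count : ℕ
  mem : Memory M w
  acc : List (Fin P × Word w)
  buf : List (Word w)

/-- The state before the simulation of processor `i`. -/
def State.start {P M w : ℕ} (i : ℕ) : State P M w := ⟨0, i, 0, fun _ => 0, [], []⟩

/-- The states that occur in a simulation on `p` machines, where processors have names of `k`
words. -/
structure State.Good {P M w : ℕ} (p k : ℕ) (s : State P M w) : Prop where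
  phase_le : s.phase ≤ p + 3
  proc_le : s.proc ≤ P
  count_le : s.count ≤ (2 * k + 1) * (M * P)
  acc_le : s.acc.length ≤ M
  buf_le : s.buf.length ≤ 2 * k

/-- A finite type into which the good states embed. -/
abbrev FiniteState (p k P M w : ℕ) : Type :=
  (Fin (p + 4) × Fin (P + 1) × Fin ((2 * k + 1) * (M * P) + 1)) × (Fin M → Word w) ×
    (Fin M → Option (Fin P × Word w)) × (Fin (2 * k) → Option (Word w))

/-- The embedding of the good states into a finite type. -/
def State.toFinite {P M w : ℕ} (p k : ℕ) (s : State P M w) : FiniteState p k P M w :=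
  ((Fin.ofNat _ s.phase, Fin.ofNat _ s.proc, Fin.ofNat _ s.count), s.mem,
    (fun j => s.acc[(j : ℕ)]?), fun j => s.buf[(j : ℕ)]?)

/-- The value `none` marks the end of a list, so `n` optional entries determine a list of length at
most `n`. -/
theorem ext_of_getElem? {α : Type*} {n : ℕ} {l l' : List α} (hl : l.length ≤ n)
    (hl' : l'.length ≤ n) (h : (fun j : Fin n => l[(j : ℕ)]?) = fun j : Fin n => l'[(j : ℕ)]?) :
    l = l' := by
  refine List.ext_getElem? fun j => ?_
  by_cases hj : j < n
  · exact congrFun h ⟨j, hj⟩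
  · rw [List.getElem?_eq_none (by omega), List.getElem?_eq_none (by omega)]

theorem ofNat_inj {n a b : ℕ} (ha : a ≤ n) (hb : b ≤ n)
    (h : Fin.ofNat (n + 1) a = Fin.ofNat (n + 1) b) : a = b := by
  have := congrArg Fin.val h
  simpa [Fin.ofNat, Nat.mod_eq_of_lt (Nat.lt_succ_of_le ha),
    Nat.mod_eq_of_lt (Nat.lt_succ_of_le hb)] using this

theorem State.injOn_toFinite {P M w : ℕ} (p k : ℕ) :
    Set.InjOn (State.toFinite (P := P) (M := M) (w := w) p k) {s | s.Good p k} := by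
  rintro ⟨a, b, c, m, l, u⟩ ⟨h1, h2, h3, h4, h5⟩ ⟨a', b', c', m', l', u'⟩
    ⟨h1', h2', h3', h4', h5'⟩ h
  simp only [State.toFinite, Prod.mk.injEq] at h
  obtain ⟨⟨ha, hb, hc⟩, rfl, hl, hu⟩ := h
  obtain rfl := ofNat_inj h1 h1' ha
  obtain rfl := ofNat_inj h2 h2' hb
  obtain rfl := ofNat_inj h3 h3' hc
  obtain rfl := ext_of_getElem? h4 h4' hl
  obtain rfl := ext_of_getElem? h5 h5' hu
  rfl

/-! ### Counting the states and encoding them in main memory -/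

/-- The factor in the size of the main memory. -/
def mainFactor (p k : ℕ) : ℕ :=
  (p + 4) + (k + 1) + ((2 * k + 1) + 1 + (k + 1)) + 1 + (k + 2) + 4 * k

/-- Each component has at most `2 ^ (a * (w * M))` values for a constant `a`; `mainFactor` is the
sum of these constants. A received word with its sender takes about `(k + 1) * w` bits, one more
multiple of `w` paying for the option `none`. -/
theorem card_finiteState_le {p k P M w : ℕ} (hM : 0 < M) (hw : 0 < w) (hk : P ≤ 2 ^ (k * w)) :
    Fintype.card (FiniteState p k P M w) ≤ Fintype.card (Memory (mainFactor p k * M) w) := by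
  have mono : ∀ {a b : ℕ}, a ≤ b → 2 ^ a ≤ 2 ^ b := fun h => Nat.pow_le_pow_right (by norm_num) h
  have hwM : 1 ≤ w * M := Nat.mul_pos hw hM
  have hw' : w ≤ w * M := Nat.le_mul_of_pos_right _ hM
  have const : ∀ a : ℕ, a ≤ 2 ^ (a * (w * M)) := fun a =>
    (Nat.lt_two_pow_self (n := a)).le.trans (mono (Nat.le_mul_of_pos_right _ hwM))
  have hP : P + 1 ≤ 2 ^ ((k + 1) * (w * M)) := by
    have h1 : 2 ^ (k * w) ≤ 2 ^ (k * (w * M)) := mono (Nat.mul_le_mul_left _ hw')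
    have h2 : 2 ^ (k * (w * M) + 1) ≤ 2 ^ ((k + 1) * (w * M)) := mono (by rw [add_mul]; omega)
    have h3 : 1 ≤ 2 ^ (k * (w * M)) := Nat.one_le_two_pow
    rw [pow_succ] at h2
    omega
  have hM' : M ≤ 2 ^ (1 * (w * M)) :=
    (Nat.lt_two_pow_self (n := M)).le.trans (mono (by
      rw [one_mul]; exact Nat.le_mul_of_pos_left _ hw))
  have hcount : (2 * k + 1) * (M * P) + 1 ≤ 2 ^ (((2 * k + 1) + 1 + (k + 1)) * (w * M)) := by
    -- Replacing `P` by `P + 1` absorbs the summand `1`.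
    calc (2 * k + 1) * (M * P) + 1 ≤ (2 * k + 1) * (M * (P + 1)) := by
          have : 0 < (2 * k + 1) * M := by positivity
          rw [mul_add M, mul_add (2 * k + 1), mul_one]; omega
      _ ≤ 2 ^ ((2 * k + 1) * (w * M)) * (2 ^ (1 * (w * M)) * 2 ^ ((k + 1) * (w * M))) :=
          Nat.mul_le_mul (const _) (Nat.mul_le_mul hM' hP)
      _ = _ := by rw [← pow_add, ← pow_add]; congr 1; ring
  have hacc : (P * 2 ^ w + 1) ^ M ≤ 2 ^ ((k + 2) * (w * M)) := by
    calc (P * 2 ^ w + 1) ^ M ≤ (2 ^ ((k + 2) * w)) ^ M := by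
          refine Nat.pow_le_pow_left ?_ _
          have h1 : P * 2 ^ w ≤ 2 ^ (k * w + w) := by
            rw [pow_add]; exact Nat.mul_le_mul_right _ hk
          have h2 : 2 ^ (k * w + w + 1) ≤ 2 ^ ((k + 2) * w) := mono (by rw [add_mul]; omega)
          have h3 : 1 ≤ 2 ^ (k * w + w) := Nat.one_le_two_pow
          rw [pow_succ] at h2
          omega
      _ = _ := by rw [← pow_mul]; congr 1; ring
  have hbuf : (2 ^ w + 1) ^ (2 * k) ≤ 2 ^ ((4 * k) * (w * M)) := by
    calc (2 ^ w + 1) ^ (2 * k) ≤ (2 ^ (2 * (w * M))) ^ (2 * k) := by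
          refine Nat.pow_le_pow_left ?_ _
          have h2 : 2 ^ (w + 1) ≤ 2 ^ (2 * (w * M)) := mono (by omega)
          have h3 : 1 ≤ 2 ^ w := Nat.one_le_two_pow
          rw [pow_succ] at h2
          omega
      _ = _ := by rw [← pow_mul]; congr 1; ring
  have hmem : (2 ^ w) ^ M = 2 ^ (1 * (w * M)) := by rw [← pow_mul, one_mul]
  simp only [Fintype.card_prod, Fintype.card_fin, Fintype.card_fun, Fintype.card_option,
    fintypeCard_word]
  calc _ ≤ (2 ^ ((p + 4) * (w * M)) * (2 ^ ((k + 1) * (w * M)) *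
        2 ^ (((2 * k + 1) + 1 + (k + 1)) * (w * M)))) * (2 ^ (1 * (w * M)) *
        (2 ^ ((k + 2) * (w * M)) * 2 ^ ((4 * k) * (w * M)))) :=
        Nat.mul_le_mul (Nat.mul_le_mul (const _) (Nat.mul_le_mul hP hcount))
          (Nat.mul_le_mul hmem.le (Nat.mul_le_mul hacc hbuf))
    _ = _ := by
        simp only [← pow_add, ← pow_mul]
        congr 1
        rw [mainFactor]; ring

/-- A representation of states by memory contents. -/
structure Coding (p k P M w S : ℕ) where
  encode : State P M w → Memory S w
  decode : Memory S w → State P M w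
  decode_encode : ∀ s : State P M w, s.Good p k → decode (encode s) = s
  encode_start : encode (State.start 0) = fun _ => 0

theorem State.good_start {p k P M w : ℕ} {i : ℕ} (hi : i ≤ P) :
    (State.start i : State P M w).Good p k :=
  ⟨Nat.zero_le _, hi, Nat.zero_le _, Nat.zero_le _, Nat.zero_le _⟩

theorem Coding.nonempty {p k P M w : ℕ} (hM : 0 < M) (hw : 0 < w) (hk : P ≤ 2 ^ (k * w)) :
    Nonempty (Coding p k P M w (mainFactor p k * M)) := by
  classical
  obtain ⟨f⟩ := Function.Embedding.nonempty_of_card_le (card_finiteState_le (p := p) hM hw hk)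
  -- The main memory is initially zero, so the zero memory must encode the start state; a
  -- transposition of the codes achieves this and keeps injectivity.
  let e : State P M w → Memory (mainFactor p k * M) w := fun s =>
    Equiv.swap (f ((State.start 0).toFinite p k)) (fun _ => 0) (f (s.toFinite p k))
  have he : Set.InjOn e {s | s.Good p k} := fun s hs s' hs' h =>
    State.injOn_toFinite p k hs hs' (f.injective ((Equiv.injective _) h))
  have : Nonempty (State P M w) := ⟨State.start 0⟩
  exact ⟨⟨e, Function.invFunOn e {s | s.Good p k}, fun s hs => he.leftInvOn_invFunOn hs,
    Equiv.swap_apply_left _ _⟩⟩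

/-! ### The program -/

section Program

variable {p k P M w S : ℕ} [NeZero p]

/-- The instruction that machine `a` executes in round `t` in the state `s`. -/
def instr (A : MPCAlgorithm P M w) (ν : Naming P k w) (e : State P M w → Memory S w) (t : ℕ)
    (a : Fin p) (s : State P M w) : EMPCInstr p S w :=
  if hi : s.proc < P then
    if machine p (⟨s.proc, hi⟩ : Fin P) = a then
      match s.phase with
      | 0 =>
        if h : s.count < M then
          .read (s.proc / p * M + s.count) fun v =>
            e { s with mem := Function.update s.mem ⟨s.count, h⟩ v, count := s.count + 1 }
        -- Phase `3` scans the messages from machine `0`.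
        else .internal (e { s with phase := 3, count := 0 })
      | 1 =>
        -- Neither the outgoing messages nor the new memory are kept in the state: they are
        -- recomputed at every step from the old memory and the received words.
        if h : s.count < (stream p ν (packets
            (A.compute t ⟨s.proc, hi⟩ s.mem (messagesOf s.acc)).2 ⟨s.proc, hi⟩)).length then
          .send (stream p ν (packets
            (A.compute t ⟨s.proc, hi⟩ s.mem (messagesOf s.acc)).2 ⟨s.proc, hi⟩))[s.count].1
            (stream p ν (packets
            (A.compute t ⟨s.proc, hi⟩ s.mem (messagesOf s.acc)).2 ⟨s.proc, hi⟩))[s.count].2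
            (e { s with count := s.count + 1 })
        else .internal (e { s with phase := 2, count := 0 })
      | 2 =>
        if h : s.count < M then
          .write (s.proc / p * M + s.count)
            ((A.compute t ⟨s.proc, hi⟩ s.mem (messagesOf s.acc)).1 ⟨s.count, h⟩)
            (e { s with count := s.count + 1 })
        else .internal (e (State.start (s.proc + 1)))
      | b + 3 =>
        if hb : b < p then
          .recv ⟨b, hb⟩ s.count fun o =>
            match o with
            | some v => e { s with
                acc := (scan ν ⟨s.proc, hi⟩ (s.acc, s.buf) v).1
                buf := (scan ν ⟨s.proc, hi⟩ (s.acc, s.buf) v).2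
                count := s.count + 1 }
            -- The end of this message has been reached; `b + 4` is the scanning phase of machine `b
            -- + 1`.
            | none => e { s with phase := b + 4, count := 0 }
        else .internal (e { s with phase := 1, count := 0 })
    else .internal (e (State.start (s.proc + 1)))
  -- This is the zero memory again, so every round starts in the same way.
  else .halt (e (State.start 0))

/-! ### Composition of computation steps -/

/-- The computation of machine `a` leads from the main memory `m`, external memory `ext` and sent
words `out` to `m'`, `ext'` and `out'`, whatever it costs. -/
def Reaches (N : EMPCNetwork p) (a : Fin p) (prog : Memory S w → EMPCInstr p S w) (E : ℕ)
    (inbox : Fin p → List (Word w)) (m : Memory S w) (ext : ℕ → Word w)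
    (out : Fin p → List (Word w)) (m' : Memory S w) (ext' : ℕ → Word w)
    (out' : Fin p → List (Word w)) : Prop :=
  -- `EMPCLocalRun` describes complete runs up to `halt`, so a partial run is expressed as the
  -- ability to prefix any completion.
  ∀ c, ∃ c', ∀ z, EMPCLocalRun N a prog E inbox ⟨m', ext', out', c'⟩ z →
    EMPCLocalRun N a prog E inbox ⟨m, ext, out, c⟩ z

variable {N : EMPCNetwork p} {a : Fin p} {prog : Memory S w → EMPCInstr p S w} {E : ℕ}
  {inbox : Fin p → List (Word w)} {m m' m'' : Memory S w} {ext ext' ext'' : ℕ → Word w}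
  {out out' out'' : Fin p → List (Word w)}

omit [NeZero p] in
theorem Reaches.refl : Reaches N a prog E inbox m ext out m ext out := fun c => ⟨c, fun _ h => h⟩

omit [NeZero p] in
theorem Reaches.trans (h : Reaches N a prog E inbox m ext out m' ext' out')
    (h' : Reaches N a prog E inbox m' ext' out' m'' ext'' out'') :
    Reaches N a prog E inbox m ext out m'' ext'' out'' := fun c =>
  let ⟨c', hc'⟩ := h c
  let ⟨c'', hc''⟩ := h' c'
  ⟨c'', fun z hz => hc' z (hc'' z hz)⟩

omit [NeZero p] in
theorem Reaches.internal (h : prog m = .internal m') :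
    Reaches N a prog E inbox m ext out m' ext out :=
  fun c => ⟨c, fun z hz => .internal _ z m' h hz⟩

omit [NeZero p] in
theorem Reaches.read {addr : ℕ} {next : Word w → Memory S w} (h : prog m = .read addr next)
    (ha : addr < E) : Reaches N a prog E inbox m ext out (next (ext addr)) ext out :=
  fun c => ⟨c + 1, fun z hz => .read _ z addr next h ha hz⟩

omit [NeZero p] in
theorem Reaches.write {addr : ℕ} {v : Word w} (h : prog m = .write addr v m') (ha : addr < E) :
    Reaches N a prog E inbox m ext out m' (Function.update ext addr v) out :=
  fun c => ⟨c + 1, fun z hz => .write _ z addr v m' h ha hz⟩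

omit [NeZero p] in
theorem Reaches.recv {src : Fin p} {pos : ℕ} {next : Option (Word w) → Memory S w}
    (h : prog m = .recv src pos next) :
    Reaches N a prog E inbox m ext out (next (inbox src)[pos]?) ext out :=
  fun c => ⟨c + 1, fun z hz => .recv _ z src pos next h hz⟩

omit [NeZero p] in
theorem Reaches.send {dst : Fin p} {v : Word w} (h : prog m = .send dst v m') :
    Reaches N a prog E inbox m ext out m' ext (Function.update out dst (out dst ++ [v])) :=
  fun c => ⟨c + N.commCost a dst, fun z hz => .send _ z dst v m' h hz⟩

end Program

/-! ### The simulation of a processor -/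

section Phases

variable {p k P M w S : ℕ} [NeZero p]

/-- The program of machine `a` in round `t`. -/
def program (A : MPCAlgorithm P M w) (ν : Naming P k w) (κ : Coding p k P M w S) (t : ℕ)
    (a : Fin p) (m : Memory S w) : EMPCInstr p S w :=
  instr A ν κ.encode t a (κ.decode m)

variable {A : MPCAlgorithm P M w} {ν : Naming P k w} {κ : Coding p k P M w S} {t : ℕ}

theorem program_encode {a : Fin p} {s : State P M w} (hs : s.Good p k) :
    program A ν κ t a (κ.encode s) = instr A ν κ.encode t a s := by
  rw [program, κ.decode_encode s hs]

theorem mul_le_count (i : Fin P) (c : ℕ) : c * M ≤ c * (M * P) :=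
  Nat.mul_le_mul_left _ (Nat.le_mul_of_pos_right _ i.pos)

theorem le_count (k : ℕ) (i : Fin P) : M ≤ (2 * k + 1) * (M * P) :=
  (Nat.le_mul_of_pos_left _ (Nat.succ_pos _)).trans (mul_le_count i _)

-- Every machine is given room for `P` processors although it simulates only about `P / p`; this
-- costs at most the constant factor `p`.
omit [NeZero p] in
theorem addr_lt (i : Fin P) (r : Fin M) : (i : ℕ) / p * M + r < M * P := by
  have h1 : (i : ℕ) / p + 1 ≤ P := Nat.succ_le_of_lt ((Nat.div_le_self _ _).trans_lt i.2)
  have h2 : ((i : ℕ) / p + 1) * M ≤ P * M := Nat.mul_le_mul_right _ h1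
  rw [add_mul, one_mul, mul_comm P] at h2
  exact (Nat.add_lt_add_left r.2 _).trans_le h2

variable {N : EMPCNetwork p} {a : Fin p} {inbox : Fin p → List (Word w)} {ext : ℕ → Word w}
  {out : Fin p → List (Word w)}

theorem reaches_load {i : Fin P} (ha : machine p i = a) {x : Memory M w}
    (hx : ∀ r : Fin M, ext ((i : ℕ) / p * M + r) = x r) :
    Reaches N a (program A ν κ t a) (M * P) inbox (κ.encode (State.start i)) ext out
      (κ.encode ⟨3, i, 0, x, [], []⟩) ext out := by
  have hgood : ∀ (r : ℕ) (y : Memory M w), r ≤ M →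
      State.Good p k (⟨0, i, r, y, [], []⟩ : State P M w) := fun r y hr =>
    ⟨Nat.zero_le _, i.2.le, hr.trans (le_count k i), Nat.zero_le _, Nat.zero_le _⟩
  have hloop : ∀ r ≤ M, Reaches N a (program A ν κ t a) (M * P) inbox
      (κ.encode (State.start i)) ext out
      -- Words not yet loaded are `0` as in `State.start`, so the case `r = 0` is the start state.
      (κ.encode ⟨0, i, r, fun j => if (j : ℕ) < r then x j else 0, [], []⟩) ext out := by
    intro r
    induction r with
    | zero =>
      intro _
      simp only [Nat.not_lt_zero, if_false]
      exact Reaches.refl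
    | succ r ih =>
      intro hr
      refine (ih (by omega)).trans ?_
      have hstep := Reaches.read (N := N) (a := a) (E := M * P) (inbox := inbox) (ext := ext)
        (out := out)
        (program_encode (A := A) (ν := ν) (κ := κ) (t := t) (a := a)
          (hgood r (fun j => if (j : ℕ) < r then x j else 0) (by omega)) |>.trans (by
          rw [instr, dif_pos i.2, if_pos ha]
          exact dif_pos hr)) (addr_lt i ⟨r, hr⟩)
      rw [hx] at hstep
      convert hstep using 3
      funext j
      by_cases hj : j = ⟨r, hr⟩
      · subst hj; simp
      · have : (j : ℕ) ≠ r := fun h => hj (Fin.ext h)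
        have h2 : (j : ℕ) < r + 1 ↔ (j : ℕ) < r := by omega
        simp [Function.update_of_ne hj, h2]
  refine (hloop M le_rfl).trans (Reaches.internal ?_)
  rw [program_encode (hgood M _ le_rfl), instr, dif_pos i.2, if_pos ha]
  simp

theorem reaches_scan {i : Fin P} (ha : machine p i = a) (x : Memory M w)
    {acc acc' : List (Fin P × Word w)} (b : Fin p) (hacc' : acc'.length ≤ M)
    (hlen : (inbox b).length ≤ (2 * k + 1) * (M * P))
    (hb : (inbox b).foldl (scan ν i) (acc, []) = (acc', [])) :
    Reaches N a (program A ν κ t a) (M * P) inbox (κ.encode ⟨b + 3, i, 0, x, acc, []⟩) ext out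
      (κ.encode ⟨b + 4, i, 0, x, acc', []⟩) ext out := by
  have hphase : (b : ℕ) + 3 ≤ p + 3 := by omega
  -- Here `l` is the part already read and `l'` the rest; only the result of scanning the rest is
  -- fixed, which permits induction on `l'`.
  have hloop : ∀ l l' acc buf, inbox b = l ++ l' → buf.length ≤ 2 * k →
      l'.foldl (scan ν i) (acc, buf) = (acc', []) →
      Reaches N a (program A ν κ t a) (M * P) inbox
        (κ.encode ⟨b + 3, i, l.length, x, acc, buf⟩) ext out
        (κ.encode ⟨b + 4, i, 0, x, acc', []⟩) ext out := by
    intro l l'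
    induction l' generalizing l with
    | nil =>
      intro acc buf h hbuf hfold
      obtain ⟨rfl, rfl⟩ := Prod.mk.inj hfold
      rw [List.append_nil] at h
      have hs : State.Good p k (⟨b + 3, i, l.length, x, acc, []⟩ : State P M w) :=
        ⟨hphase, i.2.le, h ▸ hlen, hacc', hbuf⟩
      have hstep := Reaches.recv (N := N) (a := a) (E := M * P) (inbox := inbox) (ext := ext)
        (out := out) (program_encode (A := A) (ν := ν) (κ := κ) (t := t) (a := a) hs |>.trans (by
          rw [instr, dif_pos i.2, if_pos ha]
          exact dif_pos b.2))
      have hnone : (inbox b)[l.length]? = none := by rw [h]; simp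
      simp only [Fin.eta, hnone] at hstep
      exact hstep
    | cons v l' ih =>
      intro acc buf h hbuf hfold
      have hl := congrArg List.length h
      rw [List.length_append, List.length_cons] at hl
      have hacc : acc.length ≤ M := by
        have := length_le_length_foldl_scan ν i (v :: l') (acc, buf)
        rw [hfold] at this
        exact this.trans hacc'
      have hs : State.Good p k (⟨b + 3, i, l.length, x, acc, buf⟩ : State P M w) :=
        ⟨hphase, i.2.le, by dsimp only; omega, hacc, hbuf⟩
      have hstep := Reaches.recv (N := N) (a := a) (E := M * P) (inbox := inbox) (ext := ext)
        (out := out) (program_encode (A := A) (ν := ν) (κ := κ) (t := t) (a := a) hs |>.trans (by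
          rw [instr, dif_pos i.2, if_pos ha]
          exact dif_pos b.2))
      have hsome : (inbox b)[l.length]? = some v := by rw [h]; simp
      simp only [Fin.eta, hsome] at hstep
      refine hstep.trans ?_
      have := ih (l ++ [v]) (scan ν i (acc, buf) v).1 (scan ν i (acc, buf) v).2 (by simp [h])
        (length_scan_buf_le ν i (acc, buf) v hbuf) hfold
      rwa [List.length_append, List.length_singleton] at this
  exact hloop [] (inbox b) acc [] rfl (Nat.zero_le _) hb

theorem reaches_scan_all {m : Fin P → Fin P → List (Word w)} {i : Fin P} (ha : machine p i = a)
    (x : Memory M w) (hm : ∑ j, (m i j).length ≤ M)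
    (hlen : ∀ b, (inbox b).length ≤ (2 * k + 1) * (M * P))
    (hinbox : ∀ b, inbox b = channel ν m b P a) :
    Reaches N a (program A ν κ t a) (M * P) inbox (κ.encode ⟨3, i, 0, x, [], []⟩) ext out
      (κ.encode ⟨1, i, 0, x, receivedUpTo p m i p, []⟩) ext out := by
  have hacc := fun n => (length_receivedUpTo_le (p := p) m i n).trans hm
  have hloop : ∀ n ≤ p, Reaches N a (program A ν κ t a) (M * P) inbox
      (κ.encode ⟨3, i, 0, x, [], []⟩) ext out
      (κ.encode ⟨n + 3, i, 0, x, receivedUpTo p m i n, []⟩) ext out := by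
    intro n
    induction n with
    | zero => exact fun _ => by simpa [receivedUpTo] using Reaches.refl
    | succ n ih =>
      intro hn
      refine (ih (by omega)).trans ?_
      have h := reaches_scan (A := A) (ν := ν) (κ := κ) (t := t) (N := N) (ext := ext) (out := out)
        ha x (acc := receivedUpTo p m i n) ⟨n, hn⟩ (hacc (n + 1)) (hlen _) (by
          rw [hinbox, ← ha, foldl_scan_channel, ← receivedUpTo_succ m i ⟨n, hn⟩])
      rwa [show n + 1 + 3 = n + 4 from rfl]
  refine (hloop p le_rfl).trans (Reaches.internal ?_)
  rw [program_encode ⟨le_rfl, i.2.le, Nat.zero_le _, hacc p, Nat.zero_le _⟩, instr, dif_pos i.2,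
    if_pos ha]
  simp

theorem reaches_send {i : Fin P} (ha : machine p i = a) (x : Memory M w)
    {acc : List (Fin P × Word w)} (hacc : acc.length ≤ M)
    (hsend : ∑ j, ((A.compute t i x (messagesOf acc)).2 j).length ≤ M) :
    Reaches N a (program A ν κ t a) (M * P) inbox (κ.encode ⟨1, i, 0, x, acc, []⟩) ext out
      (κ.encode ⟨2, i, 0, x, acc, []⟩) ext
      (deliver out (stream p ν (packets (A.compute t i x (messagesOf acc)).2 i))) := by
  have hlen : (stream p ν (packets (A.compute t i x (messagesOf acc)).2 i)).length ≤
      (2 * k + 1) * (M * P) := by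
    rw [length_stream, length_packets]
    exact (Nat.mul_le_mul_left _ hsend).trans (mul_le_count i _)
  have hgood : ∀ r ≤ (stream p ν (packets (A.compute t i x (messagesOf acc)).2 i)).length,
      State.Good p k (⟨1, i, r, x, acc, []⟩ : State P M w) := fun r hr =>
    ⟨by dsimp only; omega, i.2.le, hr.trans hlen, hacc, Nat.zero_le _⟩
  have hloop : ∀ r ≤ (stream p ν (packets (A.compute t i x (messagesOf acc)).2 i)).length,
      Reaches N a (program A ν κ t a) (M * P) inbox
      (κ.encode ⟨1, i, 0, x, acc, []⟩) ext out (κ.encode ⟨1, i, r, x, acc, []⟩) ext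
      (deliver out ((stream p ν (packets (A.compute t i x (messagesOf acc)).2 i)).take r)) := by
    intro r
    induction r with
    | zero =>
      intro _
      have : deliver out ([] : List (Fin p × Word w)) = out := by funext b; simp [deliver]
      rw [List.take_zero, this]
      exact Reaches.refl
    | succ r ih =>
      intro hr
      refine (ih (by omega)).trans ?_
      rw [← List.take_append_getElem hr, deliver_append_singleton]
      refine Reaches.send ?_
      rw [program_encode (hgood r (by omega)), instr, dif_pos i.2, if_pos ha]
      exact dif_pos hr
  have h := hloop _ le_rfl
  rw [List.take_length] at h
  refine h.trans (Reaches.internal ?_)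
  rw [program_encode (hgood _ le_rfl), instr, dif_pos i.2, if_pos ha]
  exact dif_neg (lt_irrefl _)

/-- The external memory in which the memory of processor `i` is replaced by the first `n` words
of `y`. -/
def storeWords (p : ℕ) (ext : ℕ → Word w) (i : Fin P) (y : Memory M w) : ℕ → ℕ → Word w
  | 0 => ext
  | n + 1 =>
    if h : n < M then
      Function.update (storeWords p ext i y n) ((i : ℕ) / p * M + n) (y ⟨n, h⟩)
    else storeWords p ext i y n

omit [NeZero p] in
theorem storeWords_of_ne (i : Fin P) (y : Memory M w) (n addr : ℕ)
    (h : ∀ r : Fin M, addr ≠ (i : ℕ) / p * M + r) : storeWords p ext i y n addr = ext addr := by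
  induction n with
  | zero => rfl
  | succ n ih =>
    rw [storeWords]
    split_ifs with hn
    · rw [Function.update_of_ne (h ⟨n, hn⟩), ih]
    · exact ih

omit [NeZero p] in
theorem storeWords_of_lt (i : Fin P) (y : Memory M w) (n : ℕ) (r : Fin M) (h : (r : ℕ) < n) :
    storeWords p ext i y n ((i : ℕ) / p * M + r) = y r := by
  induction n with
  | zero => omega
  | succ n ih =>
    rw [storeWords]
    by_cases hr : (r : ℕ) = n
    · subst hr
      simp
    · rw [← ih (by omega)]
      split_ifs
      · rw [Function.update_of_ne (by omega)]
      · rfl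

theorem reaches_store {i : Fin P} (ha : machine p i = a) (x : Memory M w)
    {acc : List (Fin P × Word w)} (hacc : acc.length ≤ M) :
    Reaches N a (program A ν κ t a) (M * P) inbox (κ.encode ⟨2, i, 0, x, acc, []⟩) ext out
      (κ.encode (State.start (i + 1)))
      (storeWords p ext i (A.compute t i x (messagesOf acc)).1 M) out := by
  have hgood : ∀ r ≤ M, State.Good p k (⟨2, i, r, x, acc, []⟩ : State P M w) := fun r hr =>
    ⟨by dsimp only; omega, i.2.le, hr.trans (le_count k i), hacc, Nat.zero_le _⟩
  have hloop : ∀ r ≤ M, Reaches N a (program A ν κ t a) (M * P) inbox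
      (κ.encode ⟨2, i, 0, x, acc, []⟩) ext out (κ.encode ⟨2, i, r, x, acc, []⟩)
      (storeWords p ext i (A.compute t i x (messagesOf acc)).1 r) out := by
    intro r
    induction r with
    | zero => exact fun _ => Reaches.refl
    | succ r ih =>
      intro hr
      refine (ih (by omega)).trans ?_
      rw [storeWords, dif_pos (show r < M from hr)]
      refine Reaches.write ?_ (addr_lt i ⟨r, hr⟩)
      rw [program_encode (hgood r (by omega)), instr, dif_pos i.2, if_pos ha]
      exact dif_pos hr
  refine (hloop M le_rfl).trans (Reaches.internal ?_)
  rw [program_encode (hgood M le_rfl), instr, dif_pos i.2, if_pos ha]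
  exact dif_neg (lt_irrefl _)

/-- Processors of one machine agree modulo `p`, so they have different quotients and occupy disjoint
blocks. Storing one therefore leaves the others intact. -/
theorem addr_ne {i j : Fin P} (h : machine p i = machine p j) (hij : i ≠ j) (r r' : Fin M) :
    (i : ℕ) / p * M + r ≠ (j : ℕ) / p * M + r' := by
  intro he
  have hmod : (i : ℕ) % p = (j : ℕ) % p := congrArg Fin.val h
  have hM : 0 < M := r.pos
  have hdiv : (i : ℕ) / p = (j : ℕ) / p := by
    have h1 := congrArg (· / M) he
    simpa [Nat.mul_add_div hM, mul_comm _ M, Nat.div_eq_of_lt r.2, Nat.div_eq_of_lt r'.2] using h1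
  exact hij (Fin.ext (by rw [← Nat.div_add_mod (i : ℕ) p, ← Nat.div_add_mod (j : ℕ) p, hdiv, hmod]))

/-- The local computation of a machine in a round simulates the round for all its processors. -/
theorem localRun {c : MPCConfig P M w} (hrecv : ∀ i, ∑ j, (c.inbox i j).length ≤ M)
    (hsend : ∀ i, ∑ j, (A.message t c i j).length ≤ M)
    (hlen : ∀ b, (inbox b).length ≤ (2 * k + 1) * (M * P))
    (hinbox : ∀ b, inbox b = channel ν c.inbox b P a)
    (hext : ∀ i : Fin P, machine p i = a → ∀ r : Fin M, ext ((i : ℕ) / p * M + r) = c.mem i r)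
    (cost : ℝ≥0) :
    ∃ ext' cost', EMPCLocalRun N a (program A ν κ t a) (M * P) inbox
      ⟨fun _ => 0, ext, fun _ => [], cost⟩
      ⟨fun _ => 0, ext', channel ν (fun j i => A.message t c i j) a P, cost'⟩ ∧
      ∀ i : Fin P, machine p i = a → ∀ r : Fin M,
        ext' ((i : ℕ) / p * M + r) = (A.compute t i (c.mem i) (c.inbox i)).1 r := by
  -- After `n` processors the external memory is mixed: new contents below `n`, old ones from `n`
  -- on. The later processors still find their old memories, and their inboxes are unaffected by
  -- what is sent in this round.
  have hloop : ∀ n ≤ P, ∃ ext', Reaches N a (program A ν κ t a) (M * P) inbox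
      (κ.encode (State.start 0)) ext (fun _ => [])
      (κ.encode (State.start n)) ext' (channel ν (fun j i => A.message t c i j) a n) ∧
      ∀ i : Fin P, machine p i = a → ∀ r : Fin M, ext' ((i : ℕ) / p * M + r) =
        if (i : ℕ) < n then (A.compute t i (c.mem i) (c.inbox i)).1 r else c.mem i r := by
    intro n
    induction n with
    | zero =>
      refine fun _ => ⟨ext, ?_, fun i hi r => by simpa using hext i hi r⟩
      rw [channel_zero]
      exact Reaches.refl
    | succ n ih =>
      intro hn
      obtain ⟨ext', hreach, hext'⟩ := ih (by omega)
      by_cases ha : machine p (⟨n, hn⟩ : Fin P) = a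
      · have hacc : (receivedUpTo p c.inbox ⟨n, hn⟩ p).length ≤ M :=
          (length_receivedUpTo_le _ _ _).trans (hrecv _)
        have hmsg := messagesOf_receivedUpTo (p := p) c.inbox ⟨n, hn⟩
        have h1 := reaches_load (A := A) (ν := ν) (κ := κ) (t := t) (N := N) (inbox := inbox)
          (out := channel ν (fun j i => A.message t c i j) a n) ha (x := c.mem ⟨n, hn⟩)
          (fun r => by simpa using hext' ⟨n, hn⟩ ha r)
        have h2 := reaches_scan_all (A := A) (κ := κ) (t := t) (N := N) (ext := ext')
          (out := channel ν (fun j i => A.message t c i j) a n) ha (c.mem ⟨n, hn⟩) (hrecv _) hlen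
          hinbox
        have h3 := reaches_send (A := A) (ν := ν) (κ := κ) (t := t) (N := N) (inbox := inbox)
          (ext := ext') (out := channel ν (fun j i => A.message t c i j) a n) ha (c.mem ⟨n, hn⟩)
          hacc (by rw [hmsg]; exact hsend _)
        have h4 := reaches_store (A := A) (ν := ν) (κ := κ) (t := t) (N := N) (inbox := inbox)
          (ext := ext') (out := channel ν (fun j i => A.message t c i j) a (n + 1)) ha
          (c.mem ⟨n, hn⟩) hacc
        have hch : deliver (channel ν (fun j i => A.message t c i j) a n) (stream p ν (packets
            (A.compute t ⟨n, hn⟩ (c.mem ⟨n, hn⟩) (c.inbox ⟨n, hn⟩)).2 ⟨n, hn⟩)) =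
            channel ν (fun j i => A.message t c i j) a (n + 1) :=
          (channel_succ ν (fun j i => A.message t c i j) ha).symm
        rw [hmsg] at h3 h4
        rw [hch] at h3
        refine ⟨_, hreach.trans (h1.trans (h2.trans (h3.trans h4))), ?_⟩
        · intro i hi r
          by_cases hin : i = ⟨n, hn⟩
          · subst hin
            rw [storeWords_of_lt _ _ _ _ r.2, if_pos (Nat.lt_succ_self n)]
          · have hne : (i : ℕ) ≠ n := fun h => hin (Fin.ext h)
            rw [storeWords_of_ne _ _ _ _ (addr_ne (hi.trans ha.symm) hin r), hext' i hi r]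
            have : (i : ℕ) < n + 1 ↔ (i : ℕ) < n := by omega
            simp only [this]
      · refine ⟨ext', hreach.trans ?_, fun i hi r => ?_⟩
        · rw [channel_succ_of_ne ν _ ha]
          refine Reaches.internal ?_
          rw [program_encode (State.good_start (Nat.le_of_succ_le hn)), instr,
            dif_pos (show (State.start n : State P M w).proc < P from hn)]
          exact if_neg ha
        · have hne : (i : ℕ) ≠ n := by
            rintro rfl
            exact ha hi
          have : (i : ℕ) < n + 1 ↔ (i : ℕ) < n := by omega
          rw [hext' i hi r]
          simp only [this]
  obtain ⟨ext', hreach, hext'⟩ := hloop P le_rfl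
  obtain ⟨cost', hrun⟩ := hreach cost
  refine ⟨ext', cost', ?_, fun i hi r => by simpa using hext' i hi r⟩
  have hhalt := EMPCLocalRun.halt (N := N) (a := a) (prog := program A ν κ t a) (E := M * P)
    (inbox := inbox) ⟨κ.encode (State.start P), ext',
      channel ν (fun j i => A.message t c i j) a P, cost'⟩ (κ.encode (State.start 0)) (by
      rw [program_encode (State.good_start le_rfl), instr, dif_neg]
      exact lt_irrefl P)
  have := hrun _ hhalt
  rwa [κ.encode_start] at this

end Phases

/-! ### The simulation -/

/-- A step is guaranteed only from states satisfying the invariant, so sequence and invariant are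
built together, changing one value at a time. -/
theorem exists_sequence {α : Type*} {T : ℕ} {Q : ℕ → α → Prop} {R : ℕ → α → α → Prop} {x : α}
    (hx : Q 0 x) (h : ∀ t < T, ∀ y, Q t y → ∃ z, R t y z ∧ Q (t + 1) z) :
    ∃ c : ℕ → α, c 0 = x ∧ (∀ t < T, R t (c t) (c (t + 1))) ∧ ∀ t ≤ T, Q t (c t) := by
  induction T with
  | zero => exact ⟨fun _ => x, rfl, fun t ht => absurd ht (Nat.not_lt_zero t),
      fun t ht => by rwa [Nat.le_zero.1 ht]⟩
  | succ T ih =>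
    obtain ⟨c, h0, hR, hQ⟩ := ih fun t ht => h t (ht.trans (Nat.lt_succ_self T))
    obtain ⟨z, hz, hz'⟩ := h T (Nat.lt_succ_self T) (c T) (hQ T le_rfl)
    have hne : ∀ {t}, t ≤ T → Function.update c (T + 1) z t = c t := fun ht =>
      Function.update_of_ne (by omega) _ _
    refine ⟨Function.update c (T + 1) z, by rw [hne (Nat.zero_le T), h0], fun t ht => ?_,
      fun t ht => ?_⟩
    · rcases Nat.lt_succ_iff_lt_or_eq.1 ht with ht | rfl
      · rw [hne ht.le, hne ht]
        exact hR t ht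
      · rwa [hne le_rfl, Function.update_self]
    · rcases Nat.le_succ_iff.1 ht with ht | rfl
      · rw [hne ht]
        exact hQ t ht
      · rwa [Function.update_self]

/-- The machines that end every round at once, without any memory. -/
def idle (p w : ℕ) : EMPCAlgorithm p w where
  mainSize := 0
  extSize _ := 0
  bufSize _ := 0
  program _ _ m := .halt m

/-- If there is nothing to store, idle machines simulate every MPC algorithm. -/
theorem idle_simulates {p P M w : ℕ} (N : EMPCNetwork p) (A : MPCAlgorithm P M w) (T : ℕ)
    (h : P = 0 ∨ M = 0 ∨ w = 0) : (idle p w).Simulates N A T := by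
  intro x _ ext _
  refine ⟨fun _ => ⟨fun _ _ => 0, ext, fun _ _ => [], fun _ => 0⟩, rfl, fun t _ => ?_,
    fun t _ i _ _ r => ?_⟩
  · refine ⟨fun a => ⟨fun _ => 0, ext a, fun _ => [], 0⟩, fun a => .halt _ _ rfl, fun a => ?_, ?_⟩
    · simp
    · simp
  · rcases h with rfl | rfl | rfl
    · exact i.elim0
    · exact r.elim0
    · exact Subsingleton.elim _ _

section Simulator

variable {p k P M w : ℕ} [NeZero p]

/-- The simulation of an MPC algorithm by `p` machines. -/
def simulator (A : MPCAlgorithm P M w) (ν : Naming P k w)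
    (κ : Coding p k P M w (mainFactor p k * M)) : EMPCAlgorithm p w where
  mainSize := mainFactor p k * M
  extSize _ := M * P
  bufSize _ := (2 * k + 1) * (M * P)
  program := program A ν κ

theorem simulator_totalExternal (A : MPCAlgorithm P M w) (ν : Naming P k w)
    (κ : Coding p k P M w (mainFactor p k * M)) :
    (simulator A ν κ).totalExternal = p * (1 + 2 * (2 * k + 1)) * (M * P) := by
  simp only [EMPCAlgorithm.totalExternal, simulator, Finset.sum_const, Finset.card_univ,
    Fintype.card_fin, smul_eq_mul]
  ring

/-- The state `c` of the machines represents the state `d` of the processors. -/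
structure Represents {S : ℕ} (ν : Naming P k w) (c : EMPCConfig p S w) (d : MPCConfig P M w) :
    Prop where
  main : ∀ a, c.main a = fun _ => 0
  ext : EMPCAlgorithm.Stores c.ext d.mem
  inbox : ∀ a b, c.inbox a b = channel ν d.inbox b P a
  length_inbox : ∀ a b, (c.inbox a b).length ≤ (2 * k + 1) * (M * P)
  received : ∀ i, ∑ j, (d.inbox i j).length ≤ M

/-- The send bound limits the buffers and send loops of this round; the receive bound becomes part
of the invariant, where it limits the words collected in main memory in the next round. -/
theorem simulator_round (A : MPCAlgorithm P M w) (ν : Naming P k w)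
    (κ : Coding p k P M w (mainFactor p k * M)) (N : EMPCNetwork p) {t : ℕ}
    {c : EMPCConfig p (mainFactor p k * M) w} {d : MPCConfig P M w} (h : Represents ν c d)
    (hsend : ∀ i, ∑ j, (A.message t d i j).length ≤ M)
    (hrecv : ∀ j, ∑ i, (A.message t d i j).length ≤ M) :
    ∃ c', (simulator A ν κ).Round N t c c' ∧ Represents ν c'
      (⟨fun i => (A.compute t i (d.mem i) (d.inbox i)).1, fun j i => A.message t d i j⟩ :
        MPCConfig P M w) := by
  choose ext' cost' hrun hext' using fun a : Fin p =>
    localRun (A := A) (ν := ν) (κ := κ) (t := t) (N := N) (a := a) (inbox := c.inbox a)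
      (ext := c.ext a) h.received hsend (h.length_inbox a) (h.inbox a)
      (fun i hi r => h.ext i a (congrArg Fin.val hi) r) (c.cost a)
  have hbuf := sum_length_channel_le (p := p) ν (fun j i => A.message t d i j) hsend
  refine ⟨_, ⟨fun a => ⟨fun _ => 0, ext' a, channel ν (fun j i => A.message t d i j) a P, cost' a⟩,
    fun a => ?_, hbuf, rfl⟩, ⟨fun _ => rfl, ?_, fun _ _ => rfl, fun a b => ?_, hrecv⟩⟩
  · rw [h.main a]
    exact hrun a
  · exact fun i a hi r => hext' a i (Fin.ext hi) r
  · exact (Finset.single_le_sum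
      (f := fun b => (channel ν (fun j i => A.message t d i j) b P a).length)
      (fun _ _ => Nat.zero_le _) (Finset.mem_univ b)).trans (hbuf a)

theorem simulator_simulates (A : MPCAlgorithm P M w) (ν : Naming P k w)
    (κ : Coding p k P M w (mainFactor p k * M)) (N : EMPCNetwork p) {T : ℕ}
    (hA : A.RespectsMemory T) : (simulator A ν κ).Simulates N A T := by
  intro x hx ext hext
  obtain ⟨c, h0, hround, hrep⟩ := exists_sequence (T := T)
    (Q := fun t (c : EMPCConfig p (mainFactor p k * M) w) => Represents ν c (A.run x t))
    (R := (simulator A ν κ).Round N)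
    (x := ⟨fun _ _ => 0, ext, fun _ _ => [], fun _ => 0⟩)
    ⟨fun _ => rfl, hext, fun a b => (channel_nil ν b a).symm, fun _ _ => Nat.zero_le _,
      fun i => by simp [MPCAlgorithm.run]⟩
    (fun t ht c hc => simulator_round A ν κ N hc (hA x hx t ht).1 (hA x hx t ht).2)
  exact ⟨c, h0, hround, fun t ht => (hrep t ht).ext⟩

end Simulator

end EMPCSimulation

/-- Words have `w n` bits; `_hk` says that the name of a processor fits into `k` words. -/
theorem mainTheorem6 (p : ℕ) (hp : 1 ≤ p) (k : ℕ) :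
    ∃ c : ℕ, ∀ (T P M w : ℕ → ℕ) (_hk : ∀ n, P n ≤ 2 ^ (k * w n))
      (A : ∀ n, MPCAlgorithm (P n) (M n) (w n)) (_hA : ∀ n, (A n).RespectsMemory (T n))
      (N : EMPCNetwork p),
      ∃ B : ∀ n, EMPCAlgorithm p (w n), ∀ n,
        (B n).mainSize ≤ c * M n ∧
        (B n).totalExternal ≤ c * (M n * P n) ∧
        (B n).Simulates N (A n) (T n) := by
  have : NeZero p := ⟨by omega⟩
  -- The sum of the constants for main and external memory serves for both bounds.
  refine ⟨EMPCSimulation.mainFactor p k + p * (1 + 2 * (2 * k + 1)),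
    fun T P M w hk A hA N => ?_⟩
  suffices h : ∀ n, ∃ B : EMPCAlgorithm p (w n),
      B.mainSize ≤ (EMPCSimulation.mainFactor p k + p * (1 + 2 * (2 * k + 1))) * M n ∧
      B.totalExternal ≤ (EMPCSimulation.mainFactor p k + p * (1 + 2 * (2 * k + 1))) * (M n * P n) ∧
      B.Simulates N (A n) (T n) by
    choose B hB using h
    exact ⟨B, hB⟩
  intro n
  -- The encoding needs at least one bit of main memory and the decoding of names at least one
  -- processor. In the excluded cases the processors' memories carry no information.
  by_cases h : P n = 0 ∨ M n = 0 ∨ w n = 0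
  · refine ⟨EMPCSimulation.idle p (w n), Nat.zero_le _, ?_,
      EMPCSimulation.idle_simulates N (A n) (T n) h⟩
    simp [EMPCAlgorithm.totalExternal, EMPCSimulation.idle]
  · push Not at h
    obtain ⟨ν⟩ := EMPCSimulation.Naming.nonempty (Nat.pos_of_ne_zero h.1) (hk n)
    obtain ⟨κ⟩ := EMPCSimulation.Coding.nonempty (p := p) (Nat.pos_of_ne_zero h.2.1)
      (Nat.pos_of_ne_zero h.2.2) (hk n)
    refine ⟨EMPCSimulation.simulator (A n) ν κ, Nat.mul_le_mul_right _ (Nat.le_add_right _ _), ?_,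
      EMPCSimulation.simulator_simulates (A n) ν κ N (hA n)⟩
    rw [EMPCSimulation.simulator_totalExternal]
    exact Nat.mul_le_mul_right _ (Nat.le_add_left _ _)
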